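/- Let $d\ge 1$, $\tau>d/2$, and let $W_2^\tau(\mathbb R^d)$ be the Sobolev space with norm $\|(1+\|\xi\|^2)^{\tau/2}\,\hat g(\xi)\|_{L^2}$. Its elements are identified with their continuous representatives, and for $D\subseteq\mathbb R^d$ let $W_2^\tau(D)$ be the space of their restrictions to $D$, normed by the infimum of the $W_2^\tau(\mathbb R^d)$-norms of the extensions. Let $k$ be a real, symmetric, strictly positive definite kernel on a set $D\subseteq\mathbb R^d$ (for instance $D=\mathbb R^d$) which is translation invariant, $k(x,y)=\Phi(x-y)$, and has finite smoothness $\tau$, i.e. its native space (the Hilbert space of functions on $D$ with reproducing kernel $k$) consists of the same functions as $W_2^\tau(D)$, with equivalent norms. Let $\Omega\subseteq D$ be bounded and of positive (outer) Lebesgue measure (for instance $\Omega = D$, if $D$ is such a set), and let $\mathcal H_k(\Omega)$ be the native space of $k$ on $\Omega$. For a finite set $X\subset\Omega$ let $\Pi_{V(X)}$ be the orthogonal projection of $\mathcal H_k(\Omega)$ onto $V(X)=\mathrm{span}\{k(\cdot,x):x\in X\}$, and let $$P_X(x)=\sup_{0\ne f\in\mathcal H_k(\Omega)}\frac{|f(x)-\Pi_{V(X)}(f)(x)|}{\|f\|_{\mathcal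 H_k(\Omega)}},\qquad \|P_X\|_\infty=\sup_{x\in\Omega}P_X(x).$$ Then there is a constant $c_P>0$ such that for every sequence $(X_N)_{N\in\mathbb N}$ of sets $X_N\subset\Omega$ of $N$ pairwise distinct points $$\|P_{X_N}\|_\infty\ \ge\ c_P\,N^{\frac12-\frac{\tau}{d}}\qquad\text{for all } N\ge 1 .$$ Consequently the decay rate $N^{1/2-\tau/d}$ in upper bounds for the Power function is optimal: for no such sequence is $\|P_{X_N}\|_\infty=o\big(N^{1/2-\tau/d}\big)$ as $N\to\infty$. -/

import Mathlib

open MeasureTheory Filter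
open scoped ENNReal NNReal FourierTransform

namespace KernelInterp

noncomputable section

/-- Euclidean space `ℝ^d`. -/
abbrev Pt (d : ℕ) : Type := EuclideanSpace ℝ (Fin d)

/-! ### Sobolev spaces of real order -/

open Classical in
/-- The norm of the Sobolev space `W_2^τ(ℝ^d)`, i.e. the `L²` norm of
`ξ ↦ (1 + ‖ξ‖²)^{τ/2} ĝ(ξ)`, where `ĝ` is the `L²` Fourier transform of `g`.
It is `∞` if `g` is not in `L²`; so `g ∈ W_2^τ(ℝ^d)` iff the value is finite. -/
def sobolevENorm {d : ℕ} (τ : ℝ) (g : Pt d → ℝ) : ℝ≥0∞ :=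
  if h : MemLp (fun x => (g x : ℂ)) 2 (volume : Measure (Pt d)) then
    eLpNorm (fun ξ : Pt d => ((1 + ‖ξ‖ ^ 2) ^ (τ / 2) : ℝ) •
      (𝓕 (h.toLp (fun x => (g x : ℂ))) : Lp ℂ 2 (volume : Measure (Pt d))) ξ) 2 volume
  else ∞

/-- The norm of the Sobolev space `W_2^τ(D)` of functions on a set `D ⊆ ℝ^d`, `τ > d/2`: the
infimum of the `W_2^τ(ℝ^d)` norms of the extensions of `f`. As `τ > d/2`, every class in
`W_2^τ(ℝ^d)` has a unique continuous representative, and that is the function which is restricted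
to `D`. So `f ∈ W_2^τ(D)` iff the value is finite, and for `D = ℝ^d` this is the norm above. -/
def sobolevENormOn {d : ℕ} (τ : ℝ) (D : Set (Pt d)) (f : D → ℝ) : ℝ≥0∞ :=
  ⨅ (g : Pt d → ℝ) (_ : Continuous g) (_ : ∀ x : D, g x = f x), sobolevENorm τ g

/-! ### Kernels and native spaces -/

/-- `k` is a strictly positive definite kernel on `D`: symmetric, with a positive definite kernel
matrix for every finite family of pairwise distinct points of `D`. -/
def IsStrictlyPosDefKernel {d : ℕ} (D : Set (Pt d)) (k : Pt d → Pt d → ℝ) : Prop :=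
  (∀ x ∈ D, ∀ y ∈ D, k x y = k y x) ∧
  ∀ (n : ℕ) (x : Fin n → Pt d), (∀ i, x i ∈ D) → Function.Injective x →
    (Matrix.of fun i j => k (x i) (x j)).PosDef

/-- `k` is translation invariant on `D`: `k(x, y) = Φ(x - y)`. -/
def IsTranslationInvariant {d : ℕ} (D : Set (Pt d)) (k : Pt d → Pt d → ℝ) : Prop :=
  ∃ Φ : Pt d → ℝ, ∀ x ∈ D, ∀ y ∈ D, k x y = Φ (x - y)

section Native

variable {d : ℕ} {D : Set (Pt d)}

/-- The Hilbert space `H` of functions on `D` is the native space of `k` on `D`: its reproducing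
kernel is `k`. (By Moore-Aronszajn, `H` is then unique as a Hilbert space of functions.) -/
def IsNativeSpace (k : Pt d → Pt d → ℝ) (H : Type*) [NormedAddCommGroup H]
    [InnerProductSpace ℝ H] [CompleteSpace H] [RKHS ℝ H D ℝ] : Prop :=
  ∀ x y : D, RKHS.kernel H x y 1 = k x y

/-- The Hilbert space `H` of functions on `D` is norm equivalent to `W_2^τ(D)`: it consists of the
same functions, and the norms are equivalent. -/
def NormEquivSobolev (τ : ℝ) (H : Type*) [NormedAddCommGroup H]
    [InnerProductSpace ℝ H] [RKHS ℝ H D ℝ] : Prop :=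
  (∀ f : D → ℝ, (∃ h : H, ⇑h = f) ↔ sobolevENormOn τ D f < ∞) ∧
  ∃ c C : ℝ≥0, 0 < c ∧ 0 < C ∧ ∀ h : H,
    c * sobolevENormOn τ D h ≤ ‖h‖ₑ ∧ ‖h‖ₑ ≤ C * sobolevENormOn τ D h

/-- `k`, as a kernel on `D`, has finite smoothness `τ`: its native space on `D` is norm equivalent
to `W_2^τ(D)`. -/
def HasFiniteSmoothness (D : Set (Pt d)) (k : Pt d → Pt d → ℝ) (τ : ℝ) : Prop :=
  ∃ (H : Type) (_ : NormedAddCommGroup H) (_ : InnerProductSpace ℝ H) (_ : CompleteSpace H)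
    (_ : RKHS ℝ H D ℝ), IsNativeSpace k H ∧ NormEquivSobolev τ H

/-! ### Interpolation and the Power function -/

variable (H : Type*) [NormedAddCommGroup H] [InnerProductSpace ℝ H] [CompleteSpace H]
  [RKHS ℝ H D ℝ]

/-- `V(X) = span {k(·, x) : x ∈ X}`, a subspace of the native space. -/
def kernelSpan (X : Finset D) : Submodule ℝ H :=
  Submodule.span ℝ ((fun x : D => RKHS.kerFun H x (1 : ℝ)) '' (X : Set D))

instance (X : Finset D) : FiniteDimensional ℝ (kernelSpan H X) :=
  FiniteDimensional.span_of_finite ℝ (X.finite_toSet.image _)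

instance (X : Finset D) : (kernelSpan H X).HasOrthogonalProjection :=
  haveI : CompleteSpace (kernelSpan H X) := FiniteDimensional.complete ℝ _
  inferInstance

/-- The interpolant `Π_{V(X)}(f)`: the orthogonal projection of `f` onto `V(X)`. -/
def interpolant (X : Finset D) (f : H) : H := (kernelSpan H X).starProjection f

/-- The Power function `P_X(x) = sup_{f ≠ 0} |f(x) - Π_{V(X)}(f)(x)| / ‖f‖`. -/
def powerFunction (X : Finset D) (x : D) : ℝ :=
  ⨆ f : {f : H // f ≠ 0}, |f.1 x - interpolant H X f.1 x| / ‖f.1‖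

/-- The supremum norm `‖P_X‖_∞ = sup_x P_X(x)` of the Power function. -/
def powerFunctionSup (X : Finset D) : ℝ := ⨆ x : D, powerFunction H X x

end Native

end

end KernelInterp

/-! The N balls of radius r of order N^{-1/d} about the points of X are too small to cover Ω, so
some x in Ω is at distance more than r from X (`exists_forall_lt_dist`). A bump of width r at x is 1
there, vanishes on X, and has Sobolev norm at most of order r^{d/2-τ}
(`exists_bump_sobolevENorm_le`). By norm equivalence it restricts to an h in the native space on D
with the same bound. Since h(x) = 1 and h = 0 on X, duality gives 1 ≤ ‖h‖ P_X(x)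
(`abs_apply_le_norm_mul_powerFunction`), hence P_X(x) is at least of order r^{τ-d/2}, that is,
N^{1/2-τ/d}. -/

namespace KernelInterp

/-! ### Scaling of Sobolev norms -/

section Fourier

variable {d : ℕ}

/-- The Fourier transform of a translated dilate, in absolute value. -/
lemma norm_fourier_comp_smul_sub (f : Pt d → ℂ) (x : Pt d) {r : ℝ} (hr : 0 < r) (ξ : Pt d) :
    ‖𝓕 (fun y => f (r⁻¹ • (y - x))) ξ‖ = r ^ d * ‖𝓕 f (r • ξ)‖ := by
  have h1 : 𝓕 (fun y => f (r⁻¹ • (y - x))) ξ =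
      Real.fourierChar (-inner ℝ x ξ) •
        ∫ y, Real.fourierChar (-inner ℝ (r⁻¹ • y) (r • ξ)) • f (r⁻¹ • y) := by
    rw [Real.fourier_eq, ← integral_add_right_eq_self _ x, Circle.smul_def, ← integral_smul]
    congr 1 with y
    rw [add_sub_cancel_right, inner_smul_left, inner_smul_right, inner_add_left, neg_add,
      AddChar.map_add_eq_mul, mul_comm, ← Circle.smul_def, mul_smul]
    simp [hr.ne']
  rw [h1, Circle.norm_smul,
    Measure.integral_comp_inv_smul_of_nonneg volume
      (fun y => Real.fourierChar (-inner ℝ y (r • ξ)) • f y) hr.le,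
    ← Real.fourier_eq, norm_smul, finrank_euclideanSpace_fin, Real.norm_of_nonneg (by positivity)]

/-- The `L²` norm of a dilate. -/
lemma eLpNorm_two_comp_smul {F : Type*} [NormedAddCommGroup F] (f : Pt d → F)
    {r : ℝ} (hr : 0 < r) :
    eLpNorm (fun ξ => f (r • ξ)) 2 (volume : Measure (Pt d)) =
      ENNReal.ofReal (r ^ (-(d : ℝ) / 2)) * eLpNorm f 2 volume := by
  have hemb : MeasurableEmbedding (fun ξ : Pt d => r • ξ) :=
    (Homeomorph.smulOfNeZero r hr.ne').measurableEmbedding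
  have h := hemb.eLpNorm_map_measure (g := f) (p := 2) (μ := volume)
  rw [Measure.map_addHaar_smul volume hr.ne', finrank_euclideanSpace_fin,
    abs_of_pos (by positivity), eLpNorm_smul_measure_of_ne_top (by simp)] at h
  rw [show (fun ξ => f (r • ξ)) = f ∘ (r • ·) from rfl, ← h, smul_eq_mul,
    ENNReal.ofReal_rpow_of_pos (by positivity)]
  congr 2
  rw [← Real.rpow_natCast, ← Real.rpow_neg hr.le, ← Real.rpow_mul hr.le]
  congr 1
  simp; ring

/-- The Sobolev norm of a Schwartz function is the `L²` norm of the weighted Fourier transform. -/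
lemma sobolevENorm_eq_of_schwartz (τ : ℝ) (g : Pt d → ℝ) (G : SchwartzMap (Pt d) ℂ)
    (hG : ∀ x, G x = g x) :
    sobolevENorm τ g =
      eLpNorm (fun ξ : Pt d => ((1 + ‖ξ‖ ^ 2) ^ (τ / 2) : ℝ) • 𝓕 (fun x => (g x : ℂ)) ξ)
        2 volume := by
  have hfun : (fun x => (g x : ℂ)) = G := funext fun x => (hG x).symm
  have hmem : MemLp (fun x => (g x : ℂ)) 2 (volume : Measure (Pt d)) := hfun ▸ G.memLp 2 volume
  have htoLp : hmem.toLp (fun x => (g x : ℂ)) = G.toLp 2 :=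
    MemLp.toLp_congr _ _ (Eventually.of_forall fun x => (hG x).symm)
  rw [sobolevENorm, dif_pos hmem, htoLp, SchwartzMap.toLp_fourier_eq, hfun, ← SchwartzMap.fourier_coe]
  refine eLpNorm_congr_ae ?_
  filter_upwards [(𝓕 G).coeFn_toLp 2 volume] with ξ hξ
  rw [hξ]

/-- The Bessel weight at scale `r ≤ 1`. -/
lemma one_add_norm_sq_rpow_le {τ : ℝ} (hτ : 0 ≤ τ) {r : ℝ} (hr : 0 < r) (hr1 : r ≤ 1) (ξ : Pt d) :
    (1 + ‖ξ‖ ^ 2) ^ (τ / 2) ≤ r ^ (-τ) * (1 + ‖r • ξ‖ ^ 2) ^ (τ / 2) := by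
  have h1 : r ^ (-τ) = ((r ^ 2)⁻¹) ^ (τ / 2) := by
    rw [← Real.rpow_natCast, ← Real.rpow_neg hr.le, ← Real.rpow_mul hr.le]
    congr 1
    push_cast; ring
  rw [h1, ← Real.mul_rpow (by positivity) (by positivity)]
  refine Real.rpow_le_rpow (by positivity) ?_ (by positivity)
  rw [norm_smul, Real.norm_of_nonneg hr.le, mul_pow, inv_mul_eq_div, le_div_iff₀ (by positivity)]
  -- What remains is r² + r²‖ξ‖² ≤ 1 + r²‖ξ‖².
  nlinarith [pow_le_one₀ hr.le hr1 (n := 2)]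

/-- Bump functions at scale `r`, with the Sobolev norm that scaling predicts. -/
lemma exists_bump_sobolevENorm_le (d : ℕ) {τ : ℝ} (hτ : 0 ≤ τ) :
    ∃ A : ℝ, 0 < A ∧ ∀ (x : Pt d) (r : ℝ), 0 < r → r ≤ 1 →
      ∃ g : Pt d → ℝ, Continuous g ∧ g x = 1 ∧ (∀ y, r ≤ dist y x → g y = 0) ∧
        sobolevENorm τ g ≤ ENNReal.ofReal (A * r ^ ((d : ℝ) / 2 - τ)) := by
  let ψ : ContDiffBump (0 : Pt d) := ⟨1 / 2, 1, by norm_num, by norm_num⟩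
  have hψc : HasCompactSupport (fun x => (ψ x : ℂ)) :=
    ψ.hasCompactSupport.comp_left (g := ((↑) : ℝ → ℂ)) Complex.ofReal_zero
  have hψs : ContDiff ℝ ((⊤ : ℕ∞) : WithTop ℕ∞) (fun x => (ψ x : ℂ)) :=
    Complex.ofRealCLM.contDiff.comp ψ.contDiff
  let Ψ : SchwartzMap (Pt d) ℂ := hψc.toSchwartzMap hψs
  let w : Pt d → ℝ := fun ξ => (1 + ‖ξ‖ ^ 2) ^ (τ / 2)
  have hw : w.HasTemperateGrowth :=
    Function.hasTemperateGrowth_one_add_norm_sq_rpow (Pt d) (τ / 2)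
  -- The weighted transform of the fixed bump is again Schwartz, so its L² norm `B` is finite.
  let Θ : SchwartzMap (Pt d) ℂ := SchwartzMap.smulLeftCLM ℂ w (𝓕 Ψ)
  have hΘ : ∀ ξ, Θ ξ = w ξ • 𝓕 (fun x => (ψ x : ℂ)) ξ := fun ξ =>
    SchwartzMap.smulLeftCLM_apply_apply hw (𝓕 Ψ) ξ
  set B : ℝ≥0∞ := eLpNorm Θ 2 volume
  have hB : B ≠ ∞ := (Θ.eLpNorm_lt_top 2 volume).ne
  -- Adding 1 makes the constant positive without checking `B ≠ 0`.
  refine ⟨B.toReal + 1, by positivity, fun x r hr hr1 => ?_⟩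
  let g : Pt d → ℝ := fun y => ψ (r⁻¹ • (y - x))
  refine ⟨g, ψ.continuous.comp (by fun_prop), ?_, fun y hy => ?_, ?_⟩
  · have : ψ (0 : Pt d) = 1 := ψ.one_of_mem_closedBall (by simp [ψ])
    simpa [g] using this
  · refine ψ.zero_of_le_dist ?_
    rw [dist_zero_right, norm_smul, ← dist_eq_norm, Real.norm_of_nonneg (by positivity),
      inv_mul_eq_div, le_div_iff₀ hr]
    simpa [ψ] using hy
  · have haff : HasCompactSupport (fun y => (g y : ℂ)) := by
      have hemb : Topology.IsClosedEmbedding (fun y : Pt d => r⁻¹ • (y - x)) :=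
        ((Homeomorph.subRight x).trans
          (Homeomorph.smulOfNeZero r⁻¹ (inv_ne_zero hr.ne'))).isClosedEmbedding
      exact hψc.comp_isClosedEmbedding hemb
    have hsm : ContDiff ℝ ((⊤ : ℕ∞) : WithTop ℕ∞) (fun y => (g y : ℂ)) :=
      hψs.comp (by fun_prop)
    rw [sobolevENorm_eq_of_schwartz τ g (haff.toSchwartzMap hsm) fun _ => rfl]
    -- The exponent d/2 - τ is d from the transform of the dilate, -τ from the weight, and -d/2 from
    -- the L² norm of a dilate.
    have hpt : ∀ ξ : Pt d, ‖((1 + ‖ξ‖ ^ 2) ^ (τ / 2) : ℝ) • 𝓕 (fun y => (g y : ℂ)) ξ‖ ≤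
        (r ^ d * r ^ (-τ)) * ‖Θ (r • ξ)‖ := fun ξ => by
      rw [norm_smul, Real.norm_of_nonneg (by positivity), hΘ, norm_smul,
        Real.norm_of_nonneg (by positivity : 0 ≤ w (r • ξ)),
        norm_fourier_comp_smul_sub (fun y => (ψ y : ℂ)) x hr ξ]
      calc _ ≤ (r ^ (-τ) * w (r • ξ)) * (r ^ d * ‖𝓕 (fun y => (ψ y : ℂ)) (r • ξ)‖) := by
            gcongr
            exact one_add_norm_sq_rpow_le hτ hr hr1 ξ
        _ = _ := by ring
    calc _ ≤ ENNReal.ofReal (r ^ d * r ^ (-τ)) * eLpNorm (fun ξ => Θ (r • ξ)) 2 volume :=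
          eLpNorm_le_mul_eLpNorm_of_ae_le_mul (Eventually.of_forall hpt) 2
      _ = ENNReal.ofReal (r ^ ((d : ℝ) / 2 - τ)) * B := by
          rw [eLpNorm_two_comp_smul Θ hr, ← mul_assoc, ← ENNReal.ofReal_mul (by positivity),
            ← Real.rpow_natCast, ← Real.rpow_add hr, ← Real.rpow_add hr]
          congr 3
          ring
      _ ≤ _ := by
          rw [mul_comm (B.toReal + 1), ENNReal.ofReal_mul (by positivity)]
          gcongr
          exact ENNReal.le_ofReal_iff_toReal_le hB (by positivity) |>.2 (by linarith)

end Fourier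

/-! ### Volume bound for coverings -/

section Covering

/-- A set of positive outer measure has, at the scale `N^{-1/d}`, a point away from any `N`
points. -/
lemma exists_forall_lt_dist {d : ℕ} (hd : 0 < d) {Ω : Set (Pt d)} (hΩ : volume Ω ≠ 0) :
    ∃ ρ : ℝ, 0 < ρ ∧ ρ ≤ 1 ∧ ∀ (N : ℕ) (X : Finset Ω), 1 ≤ N → X.card = N →
      ∃ x : Ω, ∀ y ∈ X, ρ * (N : ℝ) ^ (-(1 / (d : ℝ))) < dist (y : Pt d) x := by
  set b : ℝ≥0∞ := volume (Metric.closedBall (0 : Pt d) 1)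
  have hb : b ≠ ∞ := measure_closedBall_lt_top.ne
  have hlim : Tendsto (fun ρ : ℝ => ENNReal.ofReal (ρ ^ d) * b) (nhdsWithin 0 (Set.Ioi 0))
      (nhds 0) := by
    have h1 : Tendsto (fun ρ : ℝ => ENNReal.ofReal (ρ ^ d)) (nhds 0) (nhds 0) := by
      have : Continuous fun ρ : ℝ => ENNReal.ofReal (ρ ^ d) :=
        ENNReal.continuous_ofReal.comp (by fun_prop)
      simpa [hd.ne'] using this.tendsto 0
    simpa using ENNReal.Tendsto.mul_const (h1.mono_left nhdsWithin_le_nhds) (Or.inr hb)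
  -- ρ^d times the unit ball volume is the total volume of N balls of radius ρ N^{-1/d}; it is made
  -- smaller than that of Ω.
  obtain ⟨ρ, hρ, hρ0, hρ1⟩ := ((hlim.eventually_lt_const (pos_iff_ne_zero.2 hΩ)).and
    (Ioo_mem_nhdsGT (zero_lt_one' ℝ))).exists
  refine ⟨ρ, hρ0, hρ1.le, fun N X hN hX => ?_⟩
  by_contra! hcon
  set r : ℝ := ρ * (N : ℝ) ^ (-(1 / (d : ℝ)))
  have hN0 : (0 : ℝ) < N := by exact_mod_cast hN
  have hr : 0 ≤ r := by positivity
  have hrd : (N : ℝ) * r ^ d = ρ ^ d := by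
    rw [mul_pow, ← Real.rpow_natCast ((N : ℝ) ^ _), ← Real.rpow_mul hN0.le, neg_mul,
      one_div_mul_cancel (by positivity), Real.rpow_neg_one]
    field_simp
  have hsub : Ω ⊆ ⋃ y ∈ X, Metric.closedBall (y : Pt d) r := fun x hx => by
    obtain ⟨y, hy, hxy⟩ := hcon ⟨x, hx⟩
    exact Set.mem_biUnion hy (by rwa [Metric.mem_closedBall, dist_comm])
  refine hρ.not_ge ?_
  calc volume Ω ≤ ∑ y ∈ X, volume (Metric.closedBall (y : Pt d) r) :=
        (measure_mono hsub).trans (measure_biUnion_finset_le X _)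
    _ = N * (ENNReal.ofReal (r ^ d) * b) := by
        simp [Measure.addHaar_closedBall' volume _ hr, hX, b]
    _ = ENNReal.ofReal (ρ ^ d) * b := by
        rw [← mul_assoc, ← ENNReal.ofReal_natCast, ← ENNReal.ofReal_mul hN0.le, hrd]

end Covering

/-! ### Duality for the Power function -/

section PowerFunction

/-- Linear combinations of families with the same Gram matrix have the same norms. -/
lemma norm_linearCombination_eq_of_inner_eq {ι H H' : Type*} [NormedAddCommGroup H]
    [InnerProductSpace ℝ H] [NormedAddCommGroup H'] [InnerProductSpace ℝ H'] {u : ι → H}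
    {v : ι → H'} (h : ∀ i j, inner ℝ (u i) (u j) = inner ℝ (v i) (v j)) (l : ι →₀ ℝ) :
    ‖Finsupp.linearCombination ℝ u l‖ = ‖Finsupp.linearCombination ℝ v l‖ := by
  rw [← sq_eq_sq₀ (norm_nonneg _) (norm_nonneg _), ← real_inner_self_eq_norm_sq,
    ← real_inner_self_eq_norm_sq]
  simp only [Finsupp.linearCombination_apply, Finsupp.sum, inner_sum, sum_inner, inner_smul_left,
    inner_smul_right, h]

variable {d : ℕ} {D : Set (Pt d)} {k : Pt d → Pt d → ℝ}
  {H : Type*} [NormedAddCommGroup H] [InnerProductSpace ℝ H] [CompleteSpace H] [RKHS ℝ H D ℝ]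

lemma inner_kerFun_one (f : H) (x : D) : inner ℝ f (RKHS.kerFun H x (1 : ℝ)) = f x := by
  simp

lemma IsNativeSpace.inner_kerFun_kerFun (hH : IsNativeSpace k H) (x y : D) :
    inner ℝ (RKHS.kerFun H x (1 : ℝ)) (RKHS.kerFun H y (1 : ℝ)) = k y x := by
  rw [inner_kerFun_one, RKHS.kerFun_apply, hH]

/-- Cauchy-Schwarz and the reproducing property, the residual being a projection of `f`. A bound is
needed because an unbounded real `⨆` defaults to 0. -/
lemma abs_sub_interpolant_div_norm_le (X : Finset D) (x : D) (f : H) :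
    |f x - interpolant H X f x| / ‖f‖ ≤ ‖RKHS.kerFun H x (1 : ℝ)‖ := by
  refine div_le_of_le_mul₀ (norm_nonneg _) (norm_nonneg _) ?_
  have h1 : f x - interpolant H X f x =
      inner ℝ (f - interpolant H X f) (RKHS.kerFun H x (1 : ℝ)) := by
    rw [inner_sub_left, inner_kerFun_one, inner_kerFun_one]
  have h2 : ‖f - interpolant H X f‖ ≤ ‖f‖ := by
    rw [interpolant, ← Submodule.starProjection_orthogonal_val]
    exact Submodule.norm_starProjection_apply_le _ _
  rw [h1, mul_comm]
  exact (abs_real_inner_le_norm _ _).trans (by gcongr)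

lemma bddAbove_powerFunction (X : Finset D) (x : D) :
    BddAbove (Set.range fun f : {f : H // f ≠ 0} =>
      |f.1 x - interpolant H X f.1 x| / ‖f.1‖) :=
  ⟨_, Set.forall_mem_range.2 fun f => abs_sub_interpolant_div_norm_le X x f.1⟩

lemma powerFunction_le_norm_kerFun (X : Finset D) (x : D) :
    powerFunction H X x ≤ ‖RKHS.kerFun H x (1 : ℝ)‖ :=
  Real.iSup_le (fun f => abs_sub_interpolant_div_norm_le X x f.1) (norm_nonneg _)

/-- The Power function is at least the distance of `k(·, x)` from `V(X)`. -/
lemma norm_kerFun_sub_interpolant_le_powerFunction (X : Finset D) (x : D) :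
    ‖RKHS.kerFun H x (1 : ℝ) - interpolant H X (RKHS.kerFun H x (1 : ℝ))‖ ≤
      powerFunction H X x := by
  set K : H := RKHS.kerFun H x (1 : ℝ)
  set v : H := K - interpolant H X K
  rcases eq_or_ne v 0 with hv | hv
  · rw [hv, norm_zero]
    exact Real.iSup_nonneg fun f => by positivity
  -- The residual `v` is itself the test function: its interpolant is 0 and v(x) = ‖v‖², so its
  -- quotient is ‖v‖.
  have hvo : v ∈ (kernelSpan H X)ᗮ := (kernelSpan H X).sub_starProjection_mem_orthogonal K
  have hPv : interpolant H X v = 0 := (Submodule.starProjection_apply_eq_zero_iff _).2 hvo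
  have hvx : v x = ‖v‖ ^ 2 := by
    have h0 : inner ℝ v (interpolant H X K) = 0 :=
      Submodule.inner_left_of_mem_orthogonal ((kernelSpan H X).starProjection_apply_mem K) hvo
    rw [← inner_kerFun_one, ← real_inner_self_eq_norm_sq]
    change inner ℝ v K = inner ℝ v (K - interpolant H X K)
    rw [inner_sub_right, h0, sub_zero]
  refine le_trans (le_of_eq ?_) (le_ciSup (bddAbove_powerFunction X x) ⟨v, hv⟩)
  have hv' : ‖v‖ ≠ 0 := norm_ne_zero_iff.2 hv
  simp only [hPv, hvx, RKHS.coe_zero, Pi.zero_apply, sub_zero, abs_pow, abs_norm]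
  field_simp

/-- A function in the native space on a larger set that vanishes on `X` bounds the Power function
from below. -/
lemma abs_apply_le_norm_mul_powerFunction {Ω : Set (Pt d)} (hΩD : Ω ⊆ D)
    {H' : Type*} [NormedAddCommGroup H'] [InnerProductSpace ℝ H'] [CompleteSpace H']
    [RKHS ℝ H' Ω ℝ] (hH : IsNativeSpace k H) (hH' : IsNativeSpace k H') (X : Finset Ω) (x : Ω)
    (f : H) (hf : ∀ y ∈ X, f (Set.inclusion hΩD y) = 0) :
    |f (Set.inclusion hΩD x)| ≤ ‖f‖ * powerFunction H' X x := by
  let u : Ω → H' := fun y => RKHS.kerFun H' y (1 : ℝ)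
  let w : Ω → H := fun y => RKHS.kerFun H (Set.inclusion hΩD y) (1 : ℝ)
  -- Both Gram matrices are given by k, so the coefficients of the projection on Ω can be used on D
  -- with the same residual norm, and no restriction map between the two spaces is needed.
  have huw : ∀ y z, inner ℝ (u y) (u z) = inner ℝ (w y) (w z) := fun y z => by
    rw [hH'.inner_kerFun_kerFun, hH.inner_kerFun_kerFun]
  obtain ⟨l, hl, hlx⟩ := (Finsupp.mem_span_image_iff_linearCombination ℝ).1
    ((kernelSpan H' X).starProjection_apply_mem (u x))
  have hnorm : ‖u x - interpolant H' X (u x)‖ = ‖w x - Finsupp.linearCombination ℝ w l‖ := by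
    have := norm_linearCombination_eq_of_inner_eq huw (Finsupp.single x 1 - l)
    rw [map_sub, map_sub, Finsupp.linearCombination_single, Finsupp.linearCombination_single,
      one_smul, one_smul] at this
    rw [← this, interpolant, ← hlx]
  have hfw : inner ℝ f (Finsupp.linearCombination ℝ w l) = 0 := by
    rw [Finsupp.linearCombination_apply, Finsupp.sum, inner_sum]
    refine Finset.sum_eq_zero fun y hy => ?_
    rw [inner_smul_right, inner_kerFun_one, hf y (hl hy), mul_zero]
  calc |f (Set.inclusion hΩD x)| = |inner ℝ f (w x - Finsupp.linearCombination ℝ w l)| := by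
        rw [inner_sub_right, hfw, sub_zero, inner_kerFun_one]
    _ ≤ ‖f‖ * ‖u x - interpolant H' X (u x)‖ := hnorm ▸ abs_real_inner_le_norm _ _
    _ ≤ _ := by
        gcongr
        exact norm_kerFun_sub_interpolant_le_powerFunction X x

/-- For a translation invariant kernel the Power function is bounded. -/
lemma powerFunction_le_powerFunctionSup (hH : IsNativeSpace k H)
    (hk : IsTranslationInvariant D k) (X : Finset D) (x : D) :
    powerFunction H X x ≤ powerFunctionSup H X := by
  obtain ⟨Φ, hΦ⟩ := hk
  -- Translation invariance gives ‖k(·, y)‖² = Φ(0) for every y.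
  refine le_ciSup (f := fun x : D => powerFunction H X x) ⟨√(Φ 0), ?_⟩ x
  refine Set.forall_mem_range.2 fun y => (powerFunction_le_norm_kerFun X y).trans (le_of_eq ?_)
  rw [norm_eq_sqrt_real_inner, hH.inner_kerFun_kerFun, hΦ _ y.2 _ y.2, sub_self]

lemma IsTranslationInvariant.mono {Ω : Set (Pt d)} (hk : IsTranslationInvariant D k)
    (h : Ω ⊆ D) : IsTranslationInvariant Ω k :=
  let ⟨Φ, hΦ⟩ := hk
  ⟨Φ, fun x hx y hy => hΦ x (h hx) y (h hy)⟩

end PowerFunction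

/-- The lower bound for the Power function. -/
theorem exists_le_powerFunctionSup {d : ℕ} (hd : 0 < d) {τ : ℝ} (hτ : (d : ℝ) / 2 < τ)
    {D Ω : Set (Pt d)} {k : Pt d → Pt d → ℝ} (hk_trans : IsTranslationInvariant D k)
    (hk_smooth : HasFiniteSmoothness D k τ) (hΩD : Ω ⊆ D) (hΩ_vol : volume Ω ≠ 0)
    (H : Type*) [NormedAddCommGroup H] [InnerProductSpace ℝ H] [CompleteSpace H] [RKHS ℝ H Ω ℝ]
    (hH : IsNativeSpace k H) :
    ∃ c : ℝ, 0 < c ∧ ∀ (N : ℕ) (X : Finset Ω), 1 ≤ N → X.card = N →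
      c * (N : ℝ) ^ (1 / 2 - τ / (d : ℝ)) ≤ powerFunctionSup H X := by
  obtain ⟨H₀, _, _, _, _, hH₀, hmem, _, C, _, hC, hnorm⟩ := hk_smooth
  obtain ⟨A, hA, hbump⟩ := exists_bump_sobolevENorm_le d (τ := τ)
    ((by positivity : (0 : ℝ) ≤ d / 2).trans hτ.le)
  obtain ⟨ρ, hρ, hρ1, hfar⟩ := exists_forall_lt_dist hd hΩ_vol
  have hC' : (0 : ℝ) < C := hC
  -- Solve 1 ≤ C A r^{d/2-τ} P_X(x) for P_X(x), with r = ρ N^{-1/d}.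
  refine ⟨(C * A)⁻¹ * ρ ^ (τ - (d : ℝ) / 2), by positivity, fun N X hN hX => ?_⟩
  have hN1 : (1 : ℝ) ≤ N := by exact_mod_cast hN
  have hN0 : (0 : ℝ) < N := by linarith
  obtain ⟨x, hx⟩ := hfar N X hN hX
  set r : ℝ := ρ * (N : ℝ) ^ (-(1 / (d : ℝ)))
  have hr : 0 < r := by positivity
  have hr1 : r ≤ 1 := mul_le_one₀ hρ1 (by positivity)
    (Real.rpow_le_one_of_one_le_of_nonpos hN1 (neg_nonpos.2 (by positivity)))
  obtain ⟨g, hgc, hgx, hg0, hgs⟩ := hbump x r hr hr1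
  have hgD : sobolevENormOn τ D (fun y : D => g y) ≤
      ENNReal.ofReal (A * r ^ ((d : ℝ) / 2 - τ)) :=
    (iInf₂_le_of_le g hgc (iInf_le _ fun _ => rfl)).trans hgs
  obtain ⟨h, hh⟩ := (hmem _).2 (hgD.trans_lt ENNReal.ofReal_lt_top)
  have hhn : ‖h‖ ≤ C * (A * r ^ ((d : ℝ) / 2 - τ)) := by
    have h1 := (hnorm h).2
    rw [hh] at h1
    have h2 : ‖h‖ₑ ≤ ENNReal.ofReal (C * (A * r ^ ((d : ℝ) / 2 - τ))) := by
      rw [ENNReal.ofReal_mul hC'.le, ENNReal.ofReal_coe_nnreal]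
      exact h1.trans (by gcongr)
    rwa [← ofReal_norm, ENNReal.ofReal_le_ofReal_iff (by positivity)] at h2
  have hP := abs_apply_le_norm_mul_powerFunction hΩD hH₀ hH X x h fun y hy => by
    rw [hh]; exact hg0 y (hx y hy).le
  have hhx : h (Set.inclusion hΩD x) = 1 := by rw [hh]; exact hgx
  rw [hhx, abs_one] at hP
  have hP0 : 0 ≤ powerFunction H X x := Real.iSup_nonneg fun f => by positivity
  have hrτ : ρ ^ (τ - (d : ℝ) / 2) * (N : ℝ) ^ (1 / 2 - τ / (d : ℝ)) =
      (r ^ ((d : ℝ) / 2 - τ))⁻¹ := by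
    rw [← Real.rpow_neg hr.le, Real.mul_rpow hρ.le (by positivity), ← Real.rpow_mul hN0.le]
    congr 2
    · ring
    · field_simp
  refine le_trans ?_ (powerFunction_le_powerFunctionSup hH (hk_trans.mono hΩD) X x)
  rw [mul_assoc, hrτ, ← mul_inv, inv_le_iff_one_le_mul₀ (by positivity), mul_assoc, mul_comm]
  exact hP.trans (by gcongr)

end KernelInterp

theorem mainTheorem2 {d : ℕ} (hd : 0 < d) {τ : ℝ} (hτ : (d : ℝ) / 2 < τ)
    (D : Set (KernelInterp.Pt d)) (k : KernelInterp.Pt d → KernelInterp.Pt d → ℝ)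
    (hk : KernelInterp.IsStrictlyPosDefKernel D k)
    (hk_trans : KernelInterp.IsTranslationInvariant D k)
    (hk_smooth : KernelInterp.HasFiniteSmoothness D k τ)
    (Ω : Set (KernelInterp.Pt d)) (hΩD : Ω ⊆ D) (hΩ_bdd : Bornology.IsBounded Ω)
    (hΩ_vol : volume Ω ≠ 0)
    (H : Type*) [NormedAddCommGroup H] [InnerProductSpace ℝ H] [CompleteSpace H] [RKHS ℝ H Ω ℝ]
    (hH : KernelInterp.IsNativeSpace k H) :
    (∃ cP : ℝ, 0 < cP ∧ ∀ X : ℕ → Finset Ω, (∀ N, (X N).card = N) →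
      ∀ N : ℕ, 1 ≤ N →
        cP * (N : ℝ) ^ (1 / 2 - τ / (d : ℝ)) ≤ KernelInterp.powerFunctionSup H (X N)) ∧
    (∀ X : ℕ → Finset Ω, (∀ N, (X N).card = N) →
      ¬ (fun N : ℕ => KernelInterp.powerFunctionSup H (X N)) =o[atTop]
        (fun N : ℕ => (N : ℝ) ^ (1 / 2 - τ / (d : ℝ)))) := by
  obtain ⟨c, hc, hle⟩ :=
    KernelInterp.exists_le_powerFunctionSup hd hτ hk_trans hk_smooth hΩD hΩ_vol H hH
  refine ⟨⟨c, hc, fun X hX N hN => hle N (X N) hN (hX N)⟩, fun X hX ho => ?_⟩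
  -- Little-o with constant c/2 contradicts the lower bound with constant c at any large N.
  obtain ⟨N, hN, hN1⟩ := ((ho.def (half_pos hc)).and (eventually_ge_atTop 1)).exists
  have hpos : (0 : ℝ) < (N : ℝ) ^ (1 / 2 - τ / (d : ℝ)) :=
    Real.rpow_pos_of_pos (by exact_mod_cast hN1) _
  rw [Real.norm_of_nonneg hpos.le] at hN
  nlinarith [hle N (X N) hN1 (hX N), Real.le_norm_self (KernelInterp.powerFunctionSup H (X N))]
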